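/- Let $\psi(x)=\Gamma'(x)/\Gamma(x)$ denote the classical digamma function on $(0,\infty)$ and let $\gamma$ be the Euler--Mascheroni constant. For every $x>0$ one has $\psi(x)+\psi(1/x)\neq 0$, so that the harmonic mean of $\psi(x)$ and $\psi(1/x)$ is well defined, and for every $x>0$ with $x\neq 1$, $$\frac{2\psi(x)\psi(1/x)}{\psi(x)+\psi(1/x)}>-\gamma,$$ while for $x=1$ equality holds. -/

import Mathlib

/-- The digamma (psi) function of a real variable, `ψ(x) = Γ'(x) / Γ(x)`. -/
noncomputable def realDigamma (x : ℝ) : ℝ := deriv Real.Gamma x / Real.Gamma x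

/-!
Write `ψ` for the digamma function, `γ` for the Euler–Mascheroni constant, `a = ψ x`, `b = ψ x⁻¹`
and `w = x + x⁻¹ - 2 = (x - 1)² / x ≥ 0`.

The functional equation `ψ (x + 1) = ψ x + 1 / x` and the asymptotics `ψ (x + n) - log n → 0`, which
follow from the log-convexity of `Γ`, show that the defect `D = -2γ - (a + b)` is the sum of the
series with terms `1 / (k + x) + 1 / (k + x⁻¹) - 2 / (k + 1)`. The term at `k = 0` is `w`, and the
later ones are nonpositive and add up to at least `-w` by comparison with a telescoping series.
Hence `0 ≤ D ≤ w` (`two_mul_gamma_add_realDigamma_add_inv_nonpos`,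
`neg_le_two_mul_gamma_add_realDigamma_add_inv`); in particular `a + b < 0`.

On the other hand, monotonicity of `ψ` applied to the functional equation gives
`a + γ ≥ 1 - x⁻¹` and `b + γ ≤ 1 - x` for `x ≥ 1`, so that `(a + γ) (b + γ) ≤ -w`
(`realDigamma_add_gamma_mul_inv_le`). Therefore
`2ab + γ(a + b) = 2(a + γ)(b + γ) + γD ≤ (γ - 2) w`,
which is negative for `x ≠ 1` because `γ < 2`. Dividing by `a + b < 0` is the claim.
-/

/-! ### The digamma function as the derivative of a convex function -/

theorem differentiableAt_log_comp_Gamma {x : ℝ} (hx : 0 < x) :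
    DifferentiableAt ℝ (Real.log ∘ Real.Gamma) x :=
  (Real.differentiableAt_Gamma fun m ↦ by
    have : (0 : ℝ) ≤ m := m.cast_nonneg
    linarith).log (Real.Gamma_pos_of_pos hx).ne'

theorem deriv_log_comp_Gamma {x : ℝ} (hx : 0 < x) :
    deriv (Real.log ∘ Real.Gamma) x = realDigamma x := by
  rw [Function.comp_def, deriv.log _ (Real.Gamma_pos_of_pos hx).ne', realDigamma]
  exact Real.differentiableAt_Gamma fun m ↦ by
    have : (0 : ℝ) ≤ m := m.cast_nonneg
    linarith

theorem realDigamma_one : realDigamma 1 = -Real.eulerMascheroniConstant := by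
  rw [realDigamma, Real.hasDerivAt_Gamma_one.deriv, Real.Gamma_one, div_one]

theorem log_Gamma_add_one {x : ℝ} (hx : 0 < x) :
    Real.log (Real.Gamma (x + 1)) = Real.log (Real.Gamma x) + Real.log x := by
  rw [Real.Gamma_add_one hx.ne', Real.log_mul hx.ne' (Real.Gamma_pos_of_pos hx).ne', add_comm]

theorem realDigamma_add_one {x : ℝ} (hx : 0 < x) :
    realDigamma (x + 1) = realDigamma x + 1 / x := by
  rw [← deriv_log_comp_Gamma hx, ← deriv_log_comp_Gamma (by positivity), ← deriv_comp_add_const,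
    one_div, ← Real.deriv_log,
    ← deriv_add (differentiableAt_log_comp_Gamma hx) (Real.differentiableAt_log hx.ne')]
  apply Filter.EventuallyEq.deriv_eq
  filter_upwards [eventually_gt_nhds hx] with y hy using log_Gamma_add_one hy

theorem monotoneOn_realDigamma : MonotoneOn realDigamma (Set.Ioi 0) := by
  intro x hx y hy hxy
  rcases hxy.eq_or_lt with rfl | h
  · rfl
  rw [← deriv_log_comp_Gamma hx, ← deriv_log_comp_Gamma hy]
  exact (Real.convexOn_log_Gamma.deriv_le_slope hx hy h (differentiableAt_log_comp_Gamma hx)).trans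
    (Real.convexOn_log_Gamma.slope_le_deriv hx hy h (differentiableAt_log_comp_Gamma hy))

theorem realDigamma_le_log {x : ℝ} (hx : 0 < x) : realDigamma x ≤ Real.log x := by
  have h := Real.convexOn_log_Gamma.deriv_le_slope (y := x + 1) hx (by simp; positivity)
    (by linarith) (differentiableAt_log_comp_Gamma hx)
  rw [deriv_log_comp_Gamma hx, slope_def_field, Function.comp, Function.comp,
    log_Gamma_add_one hx] at h
  simpa using h

theorem log_le_realDigamma_add_one {x : ℝ} (hx : 0 < x) :
    Real.log x ≤ realDigamma (x + 1) := by
  have hx1 : 0 < x + 1 := by positivity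
  have h := Real.convexOn_log_Gamma.slope_le_deriv (x := x) hx hx1
    (by linarith) (differentiableAt_log_comp_Gamma hx1)
  rw [deriv_log_comp_Gamma hx1, slope_def_field, Function.comp, Function.comp,
    log_Gamma_add_one hx] at h
  simpa using h

/-! ### The series of the digamma function -/

theorem realDigamma_add_nat {x : ℝ} (hx : 0 < x) (n : ℕ) :
    realDigamma (x + n) = realDigamma x + ∑ k ∈ Finset.range n, 1 / ((k : ℝ) + x) := by
  induction n with
  | zero => simp
  | succ n ih =>
    rw [Finset.sum_range_succ, ← add_assoc, ← ih, Nat.cast_succ, ← add_assoc,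
      realDigamma_add_one (by positivity), add_comm x]

theorem tendsto_realDigamma_add_nat_sub_log {x : ℝ} (hx : 0 < x) :
    Filter.Tendsto (fun n : ℕ ↦ realDigamma (x + n) - Real.log n) Filter.atTop (nhds 0) := by
  have lim (c : ℝ) : Filter.Tendsto (fun n : ℕ ↦ Real.log (n + c) - Real.log n)
      Filter.atTop (nhds 0) :=
    (Real.tendsto_log_comp_add_sub_log c).comp tendsto_natCast_atTop_atTop
  refine tendsto_of_tendsto_of_tendsto_of_le_of_le' (lim (x - 1)) (lim x) ?_ ?_
  · filter_upwards [Filter.eventually_ge_atTop 1] with n hn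
    have hn' : (1 : ℝ) ≤ n := by exact_mod_cast hn
    have h := log_le_realDigamma_add_one (x := n + (x - 1)) (by linarith)
    rw [show (n : ℝ) + (x - 1) + 1 = x + n by ring] at h
    linarith
  · filter_upwards with n
    have h := realDigamma_le_log (x := x + n) (by positivity)
    rw [add_comm (n : ℝ) x]
    linarith

/-- The series expansion of `ψ x + ψ x⁻¹`, normalised at `x = 1`. -/
theorem tendsto_sum_realDigamma_add_inv {x : ℝ} (hx : 0 < x) :
    Filter.Tendsto
      (fun n : ℕ ↦ ∑ k ∈ Finset.range n,
        (1 / ((k : ℝ) + x) + 1 / ((k : ℝ) + x⁻¹) - 2 * (1 / ((k : ℝ) + 1))))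
      Filter.atTop (nhds (-(2 * Real.eulerMascheroniConstant + realDigamma x + realDigamma x⁻¹))) := by
  have h := (((tendsto_realDigamma_add_nat_sub_log hx).add
    (tendsto_realDigamma_add_nat_sub_log (inv_pos.mpr hx))).sub
    ((tendsto_realDigamma_add_nat_sub_log one_pos).const_mul 2)).add_const
    (-(2 * Real.eulerMascheroniConstant + realDigamma x + realDigamma x⁻¹))
  rw [add_zero, mul_zero, sub_zero, zero_add] at h
  refine h.congr fun n ↦ ?_
  rw [realDigamma_add_nat hx, realDigamma_add_nat (inv_pos.mpr hx), realDigamma_add_nat one_pos,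
    realDigamma_one, Finset.sum_sub_distrib, Finset.sum_add_distrib, ← Finset.mul_sum]
  ring

/-! ### Bounds for the sum `ψ x + ψ x⁻¹` -/

theorem add_inv_sub_two_nonneg {x : ℝ} (hx : 0 < x) : 0 ≤ x + x⁻¹ - 2 := by
  have : x + x⁻¹ - 2 = (x - 1) ^ 2 / x := by field_simp; ring
  rw [this]
  positivity

/-- The sign of each term with `k ≥ 1` is visible in this factored form. -/
theorem series_term_eq {x : ℝ} (hx : 0 < x) (k : ℝ) (hk : 0 ≤ k) :
    1 / (k + x) + 1 / (k + x⁻¹) - 2 * (1 / (k + 1)) =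
      -((k - 1) * (x + x⁻¹ - 2) / ((k + 1) * (k ^ 2 + k * (x + x⁻¹) + 1))) := by
  have h : k ^ 2 + k * (x + x⁻¹) + 1 = (k + x) * (k + x⁻¹) := by
    field_simp
    ring
  have h1 : 0 < k + x := by positivity
  have h2 : 0 < k + x⁻¹ := by positivity
  have h3 : x * x⁻¹ = 1 := mul_inv_cancel₀ hx.ne'
  rw [h]
  generalize x⁻¹ = y at *
  field_simp
  linear_combination (-2 : ℝ) * h3

theorem series_term_nonpos {x : ℝ} (hx : 0 < x) {k : ℝ} (hk : 1 ≤ k) :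
    1 / (k + x) + 1 / (k + x⁻¹) - 2 * (1 / (k + 1)) ≤ 0 := by
  rw [series_term_eq hx k (by linarith), neg_nonpos]
  have := add_inv_sub_two_nonneg hx
  have : 0 ≤ k - 1 := by linarith
  positivity

theorem neg_telescoping_le_series_term {x : ℝ} (hx : 0 < x) {k : ℝ} (hk : 1 ≤ k) :
    -((x + x⁻¹ - 2) * (1 / k - 1 / (k + 1))) ≤
      1 / (k + x) + 1 / (k + x⁻¹) - 2 * (1 / (k + 1)) := by
  rw [series_term_eq hx k (by linarith), neg_le_neg_iff, mul_comm (k - 1), mul_div_assoc]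
  have hw := add_inv_sub_two_nonneg hx
  have hk0 : 0 < k := by linarith
  refine mul_le_mul_of_nonneg_left ?_ hw
  rw [show 1 / k - 1 / (k + 1) = 1 / (k * (k + 1)) by field_simp; ring,
    div_le_div_iff₀ (by positivity) (by positivity)]
  have h : (k - 1) * k ≤ k ^ 2 + k * (x + x⁻¹) + 1 := by
    have : 0 < k * (x + x⁻¹) := by positivity
    nlinarith
  nlinarith

theorem sum_series_le {x : ℝ} (hx : 0 < x) (n : ℕ) :
    ∑ k ∈ Finset.range (n + 1),
      (1 / ((k : ℝ) + x) + 1 / ((k : ℝ) + x⁻¹) - 2 * (1 / ((k : ℝ) + 1))) ≤ x + x⁻¹ - 2 := by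
  induction n with
  | zero => simp [add_comm]
  | succ n ih =>
    rw [Finset.sum_range_succ]
    have := series_term_nonpos hx (k := ((n + 1 : ℕ) : ℝ)) (by simp)
    linarith

theorem le_sum_series {x : ℝ} (hx : 0 < x) (n : ℕ) :
    (x + x⁻¹ - 2) * (1 / ((n : ℝ) + 1)) ≤ ∑ k ∈ Finset.range (n + 1),
      (1 / ((k : ℝ) + x) + 1 / ((k : ℝ) + x⁻¹) - 2 * (1 / ((k : ℝ) + 1))) := by
  induction n with
  | zero => simp [add_comm]
  | succ n ih =>
    rw [Finset.sum_range_succ]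
    have := neg_telescoping_le_series_term hx (k := ((n + 1 : ℕ) : ℝ)) (by simp)
    push_cast at this ⊢
    linarith

theorem two_mul_gamma_add_realDigamma_add_inv_nonpos {x : ℝ} (hx : 0 < x) :
    2 * Real.eulerMascheroniConstant + realDigamma x + realDigamma x⁻¹ ≤ 0 := by
  refine neg_nonneg.mp (ge_of_tendsto'
    ((tendsto_sum_realDigamma_add_inv hx).comp (Filter.tendsto_add_atTop_nat 1)) fun n ↦ ?_)
  have := add_inv_sub_two_nonneg hx
  exact le_trans (by positivity) (le_sum_series hx n)

theorem neg_le_two_mul_gamma_add_realDigamma_add_inv {x : ℝ} (hx : 0 < x) :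
    -(x + x⁻¹ - 2) ≤ 2 * Real.eulerMascheroniConstant + realDigamma x + realDigamma x⁻¹ :=
  neg_le.mp (le_of_tendsto'
    ((tendsto_sum_realDigamma_add_inv hx).comp (Filter.tendsto_add_atTop_nat 1)) (sum_series_le hx))

/-! ### The product `(ψ x + γ) (ψ x⁻¹ + γ)` and the harmonic mean -/

theorem one_sub_inv_le_realDigamma_add_gamma {x : ℝ} (hx : 1 ≤ x) :
    1 - x⁻¹ ≤ realDigamma x + Real.eulerMascheroniConstant := by
  have h0 : 0 < x := by linarith
  have h := monotoneOn_realDigamma (a := 1 + 1) (b := x + 1) (by simp)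
    (by simp; linarith) (by linarith)
  rw [realDigamma_add_one h0, realDigamma_add_one one_pos, realDigamma_one, one_div x] at h
  linarith

theorem realDigamma_add_gamma_le_one_sub_inv {x : ℝ} (h0 : 0 < x) (hx : x ≤ 1) :
    realDigamma x + Real.eulerMascheroniConstant ≤ 1 - x⁻¹ := by
  have h := monotoneOn_realDigamma (a := x + 1) (b := 1 + 1) (by simp; linarith)
    (by simp) (by linarith)
  rw [realDigamma_add_one h0, realDigamma_add_one one_pos, realDigamma_one, one_div x] at h
  linarith

theorem realDigamma_add_gamma_mul_inv_le {x : ℝ} (hx : 0 < x) :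
    (realDigamma x + Real.eulerMascheroniConstant) *
      (realDigamma x⁻¹ + Real.eulerMascheroniConstant) ≤ -(x + x⁻¹ - 2) := by
  wlog h : 1 ≤ x generalizing x
  · have := this (inv_pos.mpr hx) ((one_le_inv₀ hx).mpr (not_le.mp h).le)
    rw [inv_inv] at this
    linarith
  have h1 := one_sub_inv_le_realDigamma_add_gamma h
  have h2 := realDigamma_add_gamma_le_one_sub_inv (inv_pos.mpr hx) (inv_le_one_of_one_le₀ h)
  rw [inv_inv] at h2
  have h3 : 0 ≤ 1 - x⁻¹ := sub_nonneg.mpr (inv_le_one_of_one_le₀ h)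
  have h4 : (1 - x⁻¹) * (x - 1) = x + x⁻¹ - 2 := by field_simp; ring
  have h5 := mul_le_mul h1
    (by linarith : x - 1 ≤ -(realDigamma x⁻¹ + Real.eulerMascheroniConstant))
    (by linarith) (by linarith)
  linarith

theorem mainTheorem12 (x : ℝ) (hx : 0 < x) :
    realDigamma x + realDigamma (1 / x) ≠ 0 ∧
    (x ≠ 1 →
      2 * realDigamma x * realDigamma (1 / x) / (realDigamma x + realDigamma (1 / x))
        > -Real.eulerMascheroniConstant) ∧
    (x = 1 →
      2 * realDigamma x * realDigamma (1 / x) / (realDigamma x + realDigamma (1 / x))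
        = -Real.eulerMascheroniConstant) := by
  have hγ := Real.one_half_lt_eulerMascheroniConstant
  have hγ' := Real.eulerMascheroniConstant_lt_two_thirds
  have hle := two_mul_gamma_add_realDigamma_add_inv_nonpos hx
  have hge := neg_le_two_mul_gamma_add_realDigamma_add_inv hx
  have hprod := realDigamma_add_gamma_mul_inv_le hx
  rw [one_div]
  have hneg : realDigamma x + realDigamma x⁻¹ < 0 := by linarith
  refine ⟨hneg.ne, fun hx1 ↦ ?_, ?_⟩
  · rw [gt_iff_lt, lt_div_iff_of_neg hneg]
    have hw : 0 < x + x⁻¹ - 2 := by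
      rw [show x + x⁻¹ - 2 = (x - 1) ^ 2 / x by field_simp; ring]
      have := sub_ne_zero.mpr hx1
      positivity
    have hD := mul_le_mul_of_nonneg_left hge (by linarith : 0 ≤ Real.eulerMascheroniConstant)
    have hγw := mul_lt_mul_of_pos_right (by linarith : Real.eulerMascheroniConstant < 2) hw
    linarith
  · rintro rfl
    rw [inv_one, realDigamma_one]
    field_simp
    ring
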